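/- Let $n\ge 1$ and let $M$ be a nonzero nilpotent real $(2n-1)\times(2n-1)$ matrix. Let $\mathfrak g_M=\mathbb R e_0\ltimes_M\mathbb R^{2n-1}$ be the $2n$-dimensional nilpotent almost abelian Lie algebra in which $\mathbb R^{2n-1}$ is an abelian ideal and $[e_0,v]=Mv$ for $v\in\mathbb R^{2n-1}$. Write $\mathcal J_r$ for the $r\times r$ nilpotent Jordan block and $0_t$ for the $t\times t$ zero matrix, and let $k\ge 1$, $n_1>\dots>n_k\ge 2$, $p_1,\dots,p_k\ge 1$, $t\ge 0$ be the integers, with $\sum_i n_ip_i+t=2n-1$, for which $M$ is conjugate to $$\mathcal J_{n_1}^{\oplus p_1}\oplus\cdots\oplus\mathcal J_{n_k}^{\oplus p_k}\oplus 0_t .$$ Then $\mathfrak g_M$ admits a symplectic structure, that is, a non-degenerate alternating bilinear form $\omega$ with $\omega([x,y],z)+\omega([y,z],x)+\omega([z,x],y)=0$ for all $x,y,z\in\mathfrak g_M$, if and only if one of the following conditions holds: (i) $t$ is odd, and $p_i$ is even for every $i$ such that $n_i$ is odd; (ii) $t$ is even, and there is a unique $\ell\in\{1,\dots,k\}$ such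 that $n_\ell$ and $p_\ell$ are both odd. -/

import Mathlib

/-- The almost abelian Lie algebra `𝔤_A = ℝ e₀ ⋉_A ℝ^d` of a real `d × d` matrix `A`: the element
with fields `s` and `v` is `s e₀ + v`, with `[e₀, v] = A v` and with `ℝ^d` an abelian ideal. -/
@[ext]
structure AlmostAbelian {d : ℕ} (A : Matrix (Fin d) (Fin d) ℝ) : Type where
  s : ℝ
  v : Fin d → ℝ

namespace AlmostAbelian

variable {d : ℕ} (A : Matrix (Fin d) (Fin d) ℝ)

/-- As a set, `𝔤_A` is `ℝ × ℝ^d`. -/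
def toProd : AlmostAbelian A ≃ ℝ × (Fin d → ℝ) where
  toFun x := (x.s, x.v)
  invFun y := ⟨y.1, y.2⟩
  left_inv _ := rfl
  right_inv _ := rfl

instance : AddCommGroup (AlmostAbelian A) := (toProd A).addCommGroup

instance : Module ℝ (AlmostAbelian A) := (toProd A).module ℝ

/-- `[s e₀ + v, t e₀ + w] = s A w - t A v`. -/
instance : Bracket (AlmostAbelian A) (AlmostAbelian A) where
  bracket x y := ⟨0, x.s • A.mulVec y.v - y.s • A.mulVec x.v⟩

variable {A}

@[simp] theorem zero_s : (0 : AlmostAbelian A).s = 0 := rfl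
@[simp] theorem zero_v : (0 : AlmostAbelian A).v = 0 := rfl
@[simp] theorem add_s (x y : AlmostAbelian A) : (x + y).s = x.s + y.s := rfl
@[simp] theorem add_v (x y : AlmostAbelian A) : (x + y).v = x.v + y.v := rfl
@[simp] theorem smul_s (c : ℝ) (x : AlmostAbelian A) : (c • x).s = c * x.s := rfl
@[simp] theorem smul_v (c : ℝ) (x : AlmostAbelian A) : (c • x).v = c • x.v := rfl
@[simp] theorem lie_s (x y : AlmostAbelian A) : ⁅x, y⁆.s = 0 := rfl
@[simp] theorem lie_v (x y : AlmostAbelian A) :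
    ⁅x, y⁆.v = x.s • A.mulVec y.v - y.s • A.mulVec x.v := rfl

instance : LieRing (AlmostAbelian A) where
  add_lie x y z := by
    ext1
    · simp
    · simp only [lie_v, add_s, add_v, Matrix.mulVec_add, add_smul, smul_add]
      abel
  lie_add x y z := by
    ext1
    · simp
    · simp only [lie_v, add_s, add_v, Matrix.mulVec_add, add_smul, smul_add]
      abel
  lie_self x := by
    ext1 <;> simp
  leibniz_lie x y z := by
    ext1
    · simp
    · simp only [lie_v, lie_s, add_v, Matrix.mulVec_sub, Matrix.mulVec_smul, smul_sub, zero_smul,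
        smul_comm x.s, smul_comm y.s z.s]
      abel

instance : LieAlgebra ℝ (AlmostAbelian A) where
  lie_smul c x y := by
    ext1
    · simp
    · simp only [lie_v, smul_s, smul_v, Matrix.mulVec_smul, smul_sub, mul_smul, smul_comm x.s c]

end AlmostAbelian

/-- A symplectic structure on a real Lie algebra: a non-degenerate alternating bilinear form `ω`
with `dω = 0`, where `dω(x,y,z) = -ω([x,y],z) - ω([y,z],x) - ω([z,x],y)`. -/
structure IsLieSymplectic {L : Type*} [LieRing L] [LieAlgebra ℝ L]
    (ω : LinearMap.BilinForm ℝ L) : Prop where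
  isAlt : ω.IsAlt
  nondegenerate : ω.Nondegenerate
  closed : ∀ x y z : L, -ω ⁅x, y⁆ z - ω ⁅y, z⁆ x - ω ⁅z, x⁆ y = 0

/-- The Lie algebra `L` admits a symplectic structure. -/
def AdmitsSymplectic (L : Type*) [LieRing L] [LieAlgebra ℝ L] : Prop :=
  ∃ ω : LinearMap.BilinForm ℝ L, IsLieSymplectic ω

/-- The nilpotent Jordan block `𝒥_r` of size `r`, with ones just below the diagonal. -/
def nilpotentJordanBlock (r : ℕ) : Matrix (Fin r) (Fin r) ℝ :=
  Matrix.of fun i j => if (i : ℕ) = (j : ℕ) + 1 then 1 else 0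

/-- The tuples `(n₁, …, n_k; p₁, …, p_k; t)` with `k ≥ 1`, `n₁ > ⋯ > n_k ≥ 2`, `p_i > 0`, `t ≥ 0`
and `∑ n_i p_i + t = m`. They are the Jordan types of the nonzero nilpotent `m × m` matrices. -/
structure JordanTuple (m : ℕ) where
  k : ℕ
  one_le_k : 1 ≤ k
  n : Fin k → ℕ
  p : Fin k → ℕ
  t : ℕ
  n_strictAnti : StrictAnti n
  two_le_n : ∀ i, 2 ≤ n i
  p_pos : ∀ i, 0 < p i
  sum_eq : ∑ i, n i * p i + t = m

/-- Row and column indices of the matrix `𝒥_{n₁}^{⊕ p₁} ⊕ ⋯ ⊕ 𝒥_{n_k}^{⊕ p_k} ⊕ 0_t`. -/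
abbrev JordanTuple.Index {m : ℕ} (τ : JordanTuple m) : Type :=
  (Σ x : (Σ i : Fin τ.k, Fin (τ.p i)), Fin (τ.n x.1)) ⊕ Fin τ.t

/-- The matrix `𝒥_{n₁}^{⊕ p₁} ⊕ ⋯ ⊕ 𝒥_{n_k}^{⊕ p_k} ⊕ 0_t`. -/
def JordanTuple.matrix {m : ℕ} (τ : JordanTuple m) : Matrix τ.Index τ.Index ℝ :=
  Matrix.fromBlocks
    (Matrix.blockDiagonal' fun x : (Σ i : Fin τ.k, Fin (τ.p i)) =>
      nilpotentJordanBlock (τ.n x.1))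
    0 0 0

/-- `Λ(M) = (n₁, …, n_k; p₁, …, p_k; t)` for a nilpotent matrix `M`: the matrix `M` is conjugate to
`𝒥_{n₁}^{⊕ p₁} ⊕ ⋯ ⊕ 𝒥_{n_k}^{⊕ p_k} ⊕ 0_t`. The bijection `e` only numbers the basis vectors;
different choices of it give conjugate matrices. -/
def HasJordanTuple {m : ℕ} (M : Matrix (Fin m) (Fin m) ℝ) (τ : JordanTuple m) : Prop :=
  ∃ e : τ.Index ≃ Fin m, IsConj (Matrix.reindex e e τ.matrix) M

/-! A symplectic form on `𝔤_M` amounts to an alternating form `B` on the ideal for which `M` is skew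
and whose radical is a line, together with a functional nonzero on that line. With `0_t` read as `t`
blocks of size 1, both conditions say that exactly one odd block size has odd multiplicity.

Necessity: for even `k` the form `B (M ^ k · , ·)` is alternating, so its rank is even. That rank is
`∑ p i * (n i - k)` (truncated subtraction) minus `d k`, where `d k` is the dimension of the
intersection of `range (M ^ k)` with the radical. Now `d` is antitone with values in `{0, 1}`, and
each odd size of odd multiplicity forces a drop of `d` around it, so there is at most one; odd total
dimension gives at least one (`existsUnique_odd_odd`).

Sufficiency: `jordanChainPairing` gives an explicit form, pairing chains so that only the end of one
leftover odd chain is in the radical. -/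

open Module

/-! ### Even rank of alternating forms -/

/-- The rank of an alternating bilinear form on a finite-dimensional real space is even. -/
theorem LinearMap.BilinForm.IsAlt.even_finrank_range {V : Type*} [AddCommGroup V] [Module ℝ V]
    [FiniteDimensional ℝ V] {B : LinearMap.BilinForm ℝ V} (hB : B.IsAlt) :
    Even (finrank ℝ (LinearMap.range B)) := by
  obtain ⟨W, hW⟩ := Submodule.exists_isCompl (LinearMap.ker B)
  have hrank : finrank ℝ (LinearMap.range B) = finrank ℝ W := by
    have h1 := B.finrank_range_add_finrank_ker
    have h2 := Submodule.finrank_add_eq_of_isCompl hW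
    omega
  have halt : (B.restrict W).IsAlt := fun x => hB x
  have hker : LinearMap.ker (B.restrict W) = ⊥ := by
    rw [LinearMap.BilinForm.ker_restrict_eq_of_codisjoint hW.symm.codisjoint]
    · exact Submodule.disjoint_iff_comap_eq_bot.1 hW.disjoint.symm
    · intro x _ y hy
      have := LinearMap.mem_ker.1 hy
      rw [← hB.neg_eq, this]; simp
  have hnd : (B.restrict W).Nondegenerate :=
    halt.isRefl.nondegenerate_iff_separatingLeft.2
      (LinearMap.separatingLeft_iff_ker_eq_bot.2 hker)
  have hdet := (LinearMap.BilinForm.nondegenerate_iff_det_ne_zero (finBasis ℝ W)).1 hnd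
  -- The Gram matrix on a complement of the radical is invertible and skew, so `det = (-1) ^ dim *
  -- det` excludes odd dimension.
  have htr : (BilinForm.toMatrix (finBasis ℝ W) (B.restrict W)).transpose =
      -BilinForm.toMatrix (finBasis ℝ W) (B.restrict W) := by
    ext i j
    simp only [Matrix.transpose_apply, Matrix.neg_apply, BilinForm.toMatrix_apply]
    exact (halt.neg_eq _ _).symm
  have h := congrArg Matrix.det htr
  rw [Matrix.det_transpose, Matrix.det_neg, Fintype.card_fin] at h
  rw [hrank]
  by_contra hodd
  rw [Nat.not_even_iff_odd] at hodd
  rw [hodd.neg_one_pow] at h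
  exact hdet (by linarith)

/-! ### Jordan chain bases and ranks of powers -/

/-- Indices of the vectors of a basis consisting of `p i` Jordan chains of length `n i` for
each `i`. -/
abbrev JordanChainIndex {ι : Type*} (n p : ι → ℕ) : Type _ := Σ i, Fin (p i) × Fin (n i)

/-- The endomorphism `f` shifts each of the chains of the basis `b`. -/
def IsJordanChainBasis {ι V : Type*} [AddCommGroup V] [Module ℝ V] {n p : ι → ℕ}
    (f : V →ₗ[ℝ] V) (b : Basis (JordanChainIndex n p) ℝ V) : Prop :=
  ∀ i a u, f (b ⟨i, a, u⟩) =
    if h : (u : ℕ) + 1 < n i then b ⟨i, a, ⟨u + 1, h⟩⟩ else 0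

namespace IsJordanChainBasis

variable {ι V : Type*} [AddCommGroup V] [Module ℝ V] {n p : ι → ℕ}
  {f : V →ₗ[ℝ] V} {b : Basis (JordanChainIndex n p) ℝ V}

theorem pow_apply (hf : IsJordanChainBasis f b) (k : ℕ) (i : ι) (a : Fin (p i)) (u : Fin (n i)) :
    (f ^ k) (b ⟨i, a, u⟩) = if h : (u : ℕ) + k < n i then b ⟨i, a, ⟨u + k, h⟩⟩ else 0 := by
  induction k with
  | zero => simp
  | succ k ih =>
    rw [pow_succ', Module.End.mul_apply, ih]
    by_cases h : (u : ℕ) + k < n i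
    · rw [dif_pos h, hf]
      rfl
    · rw [dif_neg h, map_zero, dif_neg (by omega)]

theorem range_pow (hf : IsJordanChainBasis f b) (k : ℕ) :
    LinearMap.range (f ^ k) = Submodule.span ℝ (b '' {x | k ≤ (x.2.2 : ℕ)}) := by
  apply le_antisymm
  · rw [LinearMap.range_eq_map, ← b.span_eq, Submodule.map_span, Submodule.span_le]
    rintro _ ⟨_, ⟨⟨i, a, u⟩, rfl⟩, rfl⟩
    rw [hf.pow_apply]
    split_ifs with h
    · exact Submodule.subset_span ⟨_, by simp, rfl⟩
    · exact Submodule.zero_mem _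
  · rw [Submodule.span_le]
    rintro _ ⟨⟨i, a, u⟩, hu, rfl⟩
    have hu : k ≤ (u : ℕ) := hu
    refine ⟨b ⟨i, a, ⟨u - k, by omega⟩⟩, ?_⟩
    rw [hf.pow_apply, dif_pos (by simp only; omega)]
    congr
    simp only
    omega

theorem finrank_range_pow [Fintype ι] (hf : IsJordanChainBasis f b) (k : ℕ) :
    finrank ℝ (LinearMap.range (f ^ k)) = ∑ i, p i * (n i - k) := by
  classical
  have hcard : ∀ i, Fintype.card {u : Fin (n i) // k ≤ (u : ℕ)} = n i - k := by
    intro i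
    rw [← Fintype.card_fin (n i - k)]
    exact Fintype.card_congr
      { toFun := fun u => ⟨u.1 - k, by have := u.2; omega⟩
        invFun := fun u => ⟨⟨u + k, by omega⟩, by simp⟩
        left_inv := fun u => by ext; simp [u.2]
        right_inv := fun u => by simp }
  have e : {x : JordanChainIndex n p // k ≤ (x.2.2 : ℕ)} ≃
      Σ i, Fin (p i) × {u : Fin (n i) // k ≤ (u : ℕ)} :=
    { toFun := fun x => ⟨x.1.1, x.1.2.1, ⟨x.1.2.2, x.2⟩⟩
      invFun := fun y => ⟨⟨y.1, y.2.1, y.2.2.1⟩, y.2.2.2⟩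
      left_inv := fun _ => rfl
      right_inv := fun _ => rfl }
  have hli : LinearIndependent ℝ
      (fun x : {x : JordanChainIndex n p // k ≤ (x.2.2 : ℕ)} => b x) :=
    b.linearIndependent.comp _ Subtype.val_injective
  have := finrank_span_eq_card hli
  rw [hf.range_pow, Set.image_eq_range]
  refine this.trans ?_
  rw [Fintype.card_congr e, Fintype.card_sigma]
  simp [hcard]

end IsJordanChainBasis

/-! ### Necessity: parity of ranks -/

/-- If the numbers `∑ p i * (n i - k)` for even `k` have the parities of an antitone sequence
with values in `{0, 1}` that starts with `1`, then `n i` and `p i` are both odd for exactly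
one `i`. -/
theorem existsUnique_odd_odd {ι : Type*} [Fintype ι] {n p : ι → ℕ} (hn : Function.Injective n)
    {d : ℕ → ℕ} (hd : Antitone d) (hd1 : ∀ k, d k ≤ 1)
    (hpar : ∀ k, Even k → Even (∑ i, p i * (n i - k) + d k))
    (h0 : Odd (∑ i, p i * n i)) :
    ∃! i, Odd (n i) ∧ Odd (p i) := by
  classical
  -- Adding the sums at the even numbers `n i - 1` and `n i + 1`, a size `n j ≠ n i` contributes `0`
  -- or `2 * (n j - n i)` per block, and `n i` contributes `1`. Hence odd `p i` makes `d` drop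
  -- between these two points.
  have key : ∀ i, Odd (n i) → Odd (p i) → d (n i - 1) = 1 ∧ d (n i + 1) = 0 := by
    intro i hi hpi
    have hpos : 1 ≤ n i := hi.pos
    have h1 := hpar (n i - 1) (by obtain ⟨c, hc⟩ := hi; exact ⟨c, by omega⟩)
    have h2 := hpar (n i + 1) (by obtain ⟨c, hc⟩ := hi; exact ⟨c + 1, by omega⟩)
    have hrest : Even (∑ j ∈ Finset.univ.erase i,
        p j * ((n j - (n i - 1)) + (n j - (n i + 1)))) := by
      refine Finset.even_sum _ fun j hj => Even.mul_left ?_ _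
      have hne : n j ≠ n i := fun h => (Finset.ne_of_mem_erase hj) (hn h)
      rcases lt_or_gt_of_ne hne with h | h
      · exact ⟨0, by omega⟩
      · exact ⟨n j - n i, by omega⟩
    have hsum : ∑ j, p j * (n j - (n i - 1)) + ∑ j, p j * (n j - (n i + 1)) =
        p i + ∑ j ∈ Finset.univ.erase i, p j * ((n j - (n i - 1)) + (n j - (n i + 1))) := by
      rw [← Finset.sum_add_distrib]
      simp_rw [← mul_add]
      rw [← Finset.add_sum_erase _ _ (Finset.mem_univ i)]
      congr 1
      rw [show n i - (n i - 1) + (n i - (n i + 1)) = 1 by omega, mul_one]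
    have ha := hd1 (n i - 1)
    have hb := hd1 (n i + 1)
    have hab : d (n i + 1) ≤ d (n i - 1) := hd (by omega)
    have : Odd (d (n i - 1) + d (n i + 1)) := by
      grind
    have : d (n i - 1) + d (n i + 1) ≠ 0 ∧ d (n i - 1) + d (n i + 1) ≠ 2 := by
      constructor <;> intro h <;> rw [h] at this <;> exact absurd this (by decide)
    omega
  have hex : ∃ i, Odd (n i) ∧ Odd (p i) := by
    by_contra! hcon
    refine Nat.not_even_iff_odd.2 h0 (Finset.even_sum _ fun i _ => ?_)
    rw [Nat.even_mul]
    by_cases h : Odd (n i)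
    · exact Or.inl (Nat.not_odd_iff_even.1 (hcon i h))
    · exact Or.inr (Nat.not_odd_iff_even.1 h)
  have hlt : ∀ i j, Odd (n i) ∧ Odd (p i) → Odd (n j) ∧ Odd (p j) → ¬ n i < n j := by
    intro i j hi hj hij
    have h1 := (key i hi.1 hi.2).2
    have h2 := (key j hj.1 hj.2).1
    -- Distinct odd sizes differ by at least 2, so `d` would have to rise from 0 back to 1.
    have hij' : n i + 1 ≤ n j - 1 := by
      obtain ⟨a, ha⟩ := hi.1
      obtain ⟨c, hc⟩ := hj.1
      omega
    have := hd hij'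
    omega
  obtain ⟨i, hi⟩ := hex
  exact ⟨i, hi, fun j hj => hn (le_antisymm (not_lt.1 (hlt i j hi hj)) (not_lt.1 (hlt j i hj hi)))⟩

/-- Skew-adjointness of `f` passes to even powers in the form that `B (f ^ k · , ·)` is
alternating. -/
theorem isAlt_comp_pow_of_even {V : Type*} [AddCommGroup V] [Module ℝ V]
    {B : LinearMap.BilinForm ℝ V} (hB : B.IsAlt) {f : V →ₗ[ℝ] V}
    (hf : ∀ v w, B (f v) w = -B v (f w)) {k : ℕ} (hk : Even k) :
    LinearMap.BilinForm.IsAlt (B ∘ₗ (f ^ k)) := by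
  have hpow : ∀ (k : ℕ) v w, B ((f ^ k) v) w = (-1) ^ k * B v ((f ^ k) w) := by
    intro k
    induction k with
    | zero => simp
    | succ k ih =>
      intro v w
      rw [pow_succ, Module.End.mul_apply, ih, hf, ← Module.End.mul_apply f, ← pow_succ', pow_succ,
        pow_succ]
      ring
  intro v
  have h1 := hpow k v v
  rw [hk.neg_one_pow, one_mul] at h1
  simp only [LinearMap.comp_apply]
  have h2 := hB.neg_eq v ((f ^ k) v)
  linarith

/-- If `f` has `p i` Jordan blocks of size `n i` for each `i` and is skew for an alternating form
with radical of dimension at most one on an odd-dimensional space, then exactly one odd block size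
has odd multiplicity. -/
theorem IsJordanChainBasis.existsUnique_odd_odd {ι V : Type*} [Fintype ι] [AddCommGroup V]
    [Module ℝ V] [FiniteDimensional ℝ V] {n p : ι → ℕ} (hn : Function.Injective n)
    {f : V →ₗ[ℝ] V} {b : Basis (JordanChainIndex n p) ℝ V} (hb : IsJordanChainBasis f b)
    {B : LinearMap.BilinForm ℝ V} (hB : B.IsAlt) (hf : ∀ v w, B (f v) w = -B v (f w))
    (hker : finrank ℝ (LinearMap.ker B) ≤ 1) (hV : Odd (finrank ℝ V)) :
    ∃! i, Odd (n i) ∧ Odd (p i) := by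
  refine _root_.existsUnique_odd_odd hn
    (d := fun k => finrank ℝ (LinearMap.range (f ^ k) ⊓ LinearMap.ker B : Submodule ℝ V))
    ?_ ?_ ?_ ?_
  · intro k l hkl
    refine Submodule.finrank_mono (inf_le_inf_right _ ?_)
    obtain ⟨m, rfl⟩ := Nat.exists_eq_add_of_le hkl
    rw [pow_add]
    exact LinearMap.range_comp_le_range _ _
  · intro k
    exact (Submodule.finrank_mono inf_le_right).trans hker
  · intro k hk
    have heven := LinearMap.BilinForm.IsAlt.even_finrank_range (isAlt_comp_pow_of_even hB hf hk)
    have h1 := (B.domRestrict (LinearMap.range (f ^ k))).finrank_range_add_finrank_ker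
    have h2 := LinearMap.BilinForm.toLin_restrict_ker_eq_inf_ker B (LinearMap.range (f ^ k))
    have h3 : finrank ℝ (LinearMap.ker (B.domRestrict (LinearMap.range (f ^ k)))) =
        finrank ℝ (LinearMap.range (f ^ k) ⊓ LinearMap.ker B : Submodule ℝ V) := by
      rw [← h2]
      exact (LinearEquiv.finrank_eq (Submodule.equivMapOfInjective _
        (Submodule.injective_subtype _) _))
    -- Restricting the first argument of `B` to `range (f ^ k)` gives the rank of `B ∘ₗ (f ^ k)`,
    -- and the kernel of the restriction accounts for `d k`.
    have h4 : LinearMap.range (B.domRestrict (LinearMap.range (f ^ k))) =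
        LinearMap.range (B ∘ₗ (f ^ k)) := by
      rw [LinearMap.range_domRestrict, LinearMap.range_comp]
    rw [h3, h4, hb.finrank_range_pow] at h1
    rw [← h1]
    obtain ⟨c, hc⟩ := heven
    exact ⟨c + finrank ℝ (LinearMap.range (f ^ k) ⊓ LinearMap.ker B : Submodule ℝ V), by omega⟩
  · have := hb.finrank_range_pow 0
    rw [pow_zero, Module.End.one_eq_id, LinearMap.range_id, finrank_top] at this
    simp only [Nat.sub_zero] at this
    rwa [← this]

/-- Coefficients of a skew form on `p` Jordan chains of length `n`: the vector `u` of the chain `a`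
is paired with the vector `v` of the chain `b`. For even `n` each chain is paired with itself, for
odd `n` the chains `2 c` and `2 c + 1` are paired, and the last chain, if left over, is paired with
itself in such a way that its last vector spans the radical. -/
noncomputable def jordanChainPairing (n p a u b v : ℕ) : ℝ :=
  if Even n then if b = a ∧ u + v + 1 = n then (-1) ^ u else 0
  else if a + 1 = p ∧ Even a then if b = a ∧ u + v + 2 = n then (-1) ^ u else 0
  else if b = (if Even a then a + 1 else a - 1) ∧ u + v + 1 = n then (-1) ^ (a + u) else 0

theorem neg_one_pow_eq_neg_of_odd_add {u v : ℕ} (h : Odd (u + v)) :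
    (-1 : ℝ) ^ u = -(-1) ^ v := by
  rcases Nat.even_or_odd u with hu | hu
  · have hv : Odd v := (Nat.odd_add'.1 h).2 hu
    simp [hu.neg_one_pow, hv.neg_one_pow]
  · have hv : Even v := (Nat.odd_add.1 h).1 hu
    simp [hu.neg_one_pow, hv.neg_one_pow]

/-- On the support the two sign exponents have odd sum: `u + v` is `n - 1` for even `n` and `n - 2`
for the leftover odd chain; for paired chains `u + v` is even but `a + b` is odd. -/
theorem jordanChainPairing_swap {n p a u b v : ℕ} (ha : a < p) (hb : b < p) :
    jordanChainPairing n p a u b v = -jordanChainPairing n p b v a u := by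
  unfold jordanChainPairing
  by_cases hn : Even n
  · simp only [if_pos hn]
    by_cases h : b = a ∧ u + v + 1 = n
    · rw [if_pos h, if_pos ⟨h.1.symm, by omega⟩]
      exact neg_one_pow_eq_neg_of_odd_add (by grind)
    · rw [if_neg h, if_neg (by omega), neg_zero]
  simp only [if_neg hn]
  by_cases h1 : a + 1 = p ∧ Even a
  · rw [if_pos h1]
    by_cases h2 : b + 1 = p ∧ Even b
    · rw [if_pos h2]
      by_cases h : b = a ∧ u + v + 2 = n
      · rw [if_pos h, if_pos ⟨h.1.symm, by omega⟩]
        exact neg_one_pow_eq_neg_of_odd_add (by grind)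
      · rw [if_neg h, if_neg (by omega), neg_zero]
    · rw [if_neg h2, if_neg (by grind), if_neg (by grind), neg_zero]
  · rw [if_neg h1]
    by_cases h2 : b + 1 = p ∧ Even b
    · rw [if_pos h2, if_neg (by grind), if_neg (by grind), neg_zero]
    · rw [if_neg h2]
      by_cases h : b = (if Even a then a + 1 else a - 1) ∧ u + v + 1 = n
      · rw [if_pos h, if_pos (by grind)]
        exact neg_one_pow_eq_neg_of_odd_add (by grind)
      · rw [if_neg h, if_neg (by grind), neg_zero]

/-- Vanishing past the end of a chain matches `f` killing its last vector, so the shift identity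
needs no boundary case. -/
theorem jordanChainPairing_eq_zero_of_le {n p a u b v : ℕ} (hu : n ≤ u) :
    jordanChainPairing n p a u b v = 0 := by
  unfold jordanChainPairing
  split_ifs <;> first | rfl | omega

theorem jordanChainPairing_eq_zero_of_le' {n p a u b v : ℕ} (hv : n ≤ v) :
    jordanChainPairing n p a u b v = 0 := by
  unfold jordanChainPairing
  split_ifs <;> first | rfl | omega

/-- The support depends on `u` and `v` only through `u + v`, while the sign alternates in `u`. -/
theorem jordanChainPairing_succ (n p a u b v : ℕ) :
    jordanChainPairing n p a (u + 1) b v = -jordanChainPairing n p a u b (v + 1) := by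
  have h1 : u + 1 + v = u + (v + 1) := by omega
  unfold jordanChainPairing
  simp only [h1, pow_succ, ← add_assoc]
  split_ifs <;> ring

theorem jordanChainPairing_last {n p a b v : ℕ} (hn : Odd n) (hp : Odd p) (ha : a + 1 = p) :
    jordanChainPairing n p a (n - 1) b v = 0 := by
  unfold jordanChainPairing
  have := hn.pos
  rw [if_neg (Nat.not_even_iff_odd.2 hn), if_pos ⟨ha, by grind⟩, if_neg (by omega)]

/-- Every row of the Gram matrix except the radical one has a single nonzero entry, so nondegeneracy
can be checked one coordinate at a time. -/
theorem exists_jordanChainPairing_eq {n p a u : ℕ} (ha : a < p) (hu : u < n)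
    (h : ¬(Odd n ∧ Odd p ∧ a + 1 = p ∧ u + 1 = n)) :
    ∃ b < p, ∃ v < n, ∃ ε : ℝ, ε ≠ 0 ∧ ∀ b' v',
      jordanChainPairing n p a u b' v' = if b' = b ∧ v' = v then ε else 0 := by
  unfold jordanChainPairing
  by_cases hn : Even n
  · refine ⟨a, ha, n - 1 - u, by omega, (-1) ^ u, by simp, fun b' v' => ?_⟩
    rw [if_pos hn]
    congr 1
    grind
  by_cases h1 : a + 1 = p ∧ Even a
  · have hu' : u + 1 ≠ n := by grind
    refine ⟨a, ha, n - 2 - u, by omega, (-1) ^ u, by simp, fun b' v' => ?_⟩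
    rw [if_neg hn, if_pos h1]
    congr 1
    grind
  · refine ⟨if Even a then a + 1 else a - 1, by grind, n - 1 - u, by omega, (-1) ^ (a + u),
      by simp, fun b' v' => ?_⟩
    rw [if_neg hn, if_neg h1]
    congr 1
    grind

/-- If exactly one odd block size of `f` has odd multiplicity, then `f` is skew for an alternating
form whose radical is spanned by one vector `z`. -/
theorem IsJordanChainBasis.exists_isAlt {ι V : Type*} [AddCommGroup V]
    [Module ℝ V] {n p : ι → ℕ}
    {f : V →ₗ[ℝ] V} {b : Basis (JordanChainIndex n p) ℝ V} (hf : IsJordanChainBasis f b)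
    (hu : ∃! i, Odd (n i) ∧ Odd (p i)) :
    ∃ (B : LinearMap.BilinForm ℝ V) (α : V →ₗ[ℝ] ℝ) (z : V), B.IsAlt ∧
      (∀ v w, B (f v) w = -B v (f w)) ∧ (∀ v, B z v = 0) ∧ α z = 1 ∧
      ∀ v, (∀ w, B w v = 0) → α v = 0 → v = 0 := by
  classical
  obtain ⟨i₀, ⟨hn₀, hp₀⟩, hi₀⟩ := hu
  let A : JordanChainIndex n p → JordanChainIndex n p → ℝ := fun x y =>
    if x.1 = y.1 then jordanChainPairing (n x.1) (p x.1) x.2.1 x.2.2 y.2.1 y.2.2 else 0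
  let B : LinearMap.BilinForm ℝ V := b.constr ℝ fun x => b.constr ℝ fun y => A x y
  have hBA : ∀ x y, B (b x) (b y) = A x y := by
    intro x y
    simp only [B, Basis.constr_basis]
  let z₀ : JordanChainIndex n p :=
    ⟨i₀, ⟨p i₀ - 1, by have := hp₀.pos; omega⟩, ⟨n i₀ - 1, by have := hn₀.pos; omega⟩⟩
  have hskew : B = -B.flip := by
    refine b.ext fun x => b.ext fun y => ?_
    rw [LinearMap.neg_apply, LinearMap.neg_apply, LinearMap.BilinForm.flip_apply, hBA, hBA]
    obtain ⟨i, a, u⟩ := x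
    obtain ⟨j, c, v⟩ := y
    by_cases hij : i = j
    · subst hij
      simp only [A, if_true]
      exact jordanChainPairing_swap a.2 c.2
    · simp only [A, if_neg hij, if_neg (Ne.symm hij), neg_zero]
  have hshift : B ∘ₗ f = -(B.compl₂ f) := by
    refine b.ext fun x => b.ext fun y => ?_
    rw [LinearMap.neg_apply, LinearMap.neg_apply, LinearMap.compl₂_apply, LinearMap.comp_apply]
    obtain ⟨i, a, u⟩ := x
    obtain ⟨j, c, v⟩ := y
    have hl : B (f (b ⟨i, a, u⟩)) (b ⟨j, c, v⟩) =
        if i = j then jordanChainPairing (n i) (p i) a (u + 1) c v else 0 := by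
      rw [hf]
      split_ifs with h1 h2 h2
      · rw [hBA]; simp only [A, if_pos h2]
      · rw [hBA]; simp only [A, if_neg h2]
      · rw [map_zero, LinearMap.zero_apply, jordanChainPairing_eq_zero_of_le (by omega)]
      · rw [map_zero, LinearMap.zero_apply]
    have hr : B (b ⟨i, a, u⟩) (f (b ⟨j, c, v⟩)) =
        if i = j then jordanChainPairing (n i) (p i) a u c (v + 1) else 0 := by
      rw [hf]
      split_ifs with h1 h2 h2
      · rw [hBA]; simp only [A, if_pos h2]
      · rw [hBA]; simp only [A, if_neg h2]
      · subst h2; rw [map_zero, jordanChainPairing_eq_zero_of_le' (by omega)]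
      · rw [map_zero]
    rw [hl, hr]
    split_ifs
    · exact jordanChainPairing_succ _ _ _ _ _ _
    · exact neg_zero.symm
  refine ⟨B, b.coord z₀, b z₀, ?_, ?_, ?_, ?_, ?_⟩
  · intro v
    have := LinearMap.congr_fun₂ hskew v v
    rw [LinearMap.neg_apply, LinearMap.neg_apply, LinearMap.BilinForm.flip_apply] at this
    linarith
  · intro v w
    exact LinearMap.congr_fun₂ hshift v w
  · suffices B (b z₀) = 0 from fun v => by rw [this, LinearMap.zero_apply]
    refine b.ext fun y => ?_
    rw [hBA, LinearMap.zero_apply]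
    simp only [A, z₀]
    split_ifs
    · exact jordanChainPairing_last hn₀ hp₀ (by have := hp₀.pos; omega)
    · rfl
  · simp
  · intro v hv hz
    have hcoord : ∀ x, B (b x) v = (b.repr v).sum fun y c => c * A x y := by
      intro x
      conv_lhs => rw [← b.linearCombination_repr v]
      rw [Finsupp.linearCombination_apply, map_finsuppSum]
      refine Finsupp.sum_congr fun y _ => ?_
      rw [map_smul, hBA, smul_eq_mul]
    refine b.repr.map_eq_zero_iff.1 (Finsupp.ext fun ⟨i, c, w⟩ => ?_)
    rw [Finsupp.zero_apply]
    -- The coordinate at `z₀` is killed by `α`. For any other, the partner of `(c, w)` has, by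
    -- antisymmetry, its only nonzero entry at `(c, w)`, so pairing `v` with it isolates that
    -- coordinate.
    by_cases hlast : Odd (n i) ∧ Odd (p i) ∧ (c : ℕ) + 1 = p i ∧ (w : ℕ) + 1 = n i
    · obtain rfl := hi₀ i ⟨hlast.1, hlast.2.1⟩
      have : (⟨i, c, w⟩ : JordanChainIndex n p) = z₀ := by
        simp only [z₀]
        congr <;> grind
      rw [this]
      exact hz
    · obtain ⟨a, ha, u, hu, ε, hε, h⟩ := exists_jordanChainPairing_eq c.2 w.2 hlast
      have hne : jordanChainPairing (n i) (p i) a u c w ≠ 0 := by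
        rw [jordanChainPairing_swap ha c.2, h, if_pos ⟨rfl, rfl⟩]
        exact neg_ne_zero.2 hε
      obtain ⟨c', -, w', -, ε', hε', h'⟩ := exists_jordanChainPairing_eq ha hu (by
        rintro ⟨h1, h2, h3, h4⟩
        refine hne ?_
        rw [show u = n i - 1 by omega]
        exact jordanChainPairing_last h1 h2 h3)
      have hcw : (c : ℕ) = c' ∧ (w : ℕ) = w' := by
        by_contra hcon
        exact hne (by rw [h', if_neg hcon])
      have hrow : ∀ y, A ⟨i, ⟨a, ha⟩, ⟨u, hu⟩⟩ y = if y = ⟨i, c, w⟩ then ε' else 0 := by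
        rintro ⟨j, d, x⟩
        simp only [A]
        by_cases hij : i = j
        · subst hij
          rw [if_pos rfl, h']
          simp [Fin.ext_iff, hcw.1, hcw.2]
        · rw [if_neg hij, if_neg fun h => hij (congrArg Sigma.fst h).symm]
      have := hv (b ⟨i, ⟨a, ha⟩, ⟨u, hu⟩⟩)
      rw [hcoord] at this
      simp only [hrow, mul_ite, mul_zero] at this
      rw [Finsupp.sum_ite_eq'] at this
      by_contra hcon
      rw [if_pos (Finsupp.mem_support_iff.2 hcon)] at this
      exact (mul_ne_zero hcon hε') this

/-! ### Symplectic forms on `𝔤_A` and skew forms on the ideal -/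

namespace AlmostAbelian

variable {d : ℕ} {A : Matrix (Fin d) (Fin d) ℝ}

/-- The projection of `ℝ e₀ ⋉ ℝ^d` to `ℝ e₀`. -/
def sₗ : AlmostAbelian A →ₗ[ℝ] ℝ where
  toFun x := x.s
  map_add' _ _ := rfl
  map_smul' _ _ := rfl

/-- The projection of `ℝ e₀ ⋉ ℝ^d` to `ℝ^d`. -/
def vₗ : AlmostAbelian A →ₗ[ℝ] (Fin d → ℝ) where
  toFun x := x.v
  map_add' _ _ := rfl
  map_smul' _ _ := rfl

variable (A) in
/-- The inclusion of the abelian ideal `ℝ^d`. -/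
def incl : (Fin d → ℝ) →ₗ[ℝ] AlmostAbelian A where
  toFun v := ⟨0, v⟩
  map_add' v w := by ext1 <;> simp
  map_smul' c v := by ext1 <;> simp

/-- An alternating form on the ideal for which `A` is skew and whose radical is complemented by the
kernel of a linear functional yields a symplectic structure. -/
theorem admitsSymplectic_of_form {B : LinearMap.BilinForm ℝ (Fin d → ℝ)}
    {α : (Fin d → ℝ) →ₗ[ℝ] ℝ} {z : Fin d → ℝ} (hB : B.IsAlt)
    (hA : ∀ v w, B (A.mulVec v) w = -B v (A.mulVec w)) (hz : ∀ v, B z v = 0) (hαz : α z = 1)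
    (hrad : ∀ v, (∀ w, B w v = 0) → α v = 0 → v = 0) :
    AdmitsSymplectic (AlmostAbelian A) := by
  -- This is `B + e⁰ ∧ α`: the radical vector `z` is paired with `e₀`.
  let ω : LinearMap.BilinForm ℝ (AlmostAbelian A) :=
    B.compl₁₂ vₗ vₗ + (LinearMap.mul ℝ ℝ).compl₁₂ sₗ (α ∘ₗ vₗ) -
      (LinearMap.mul ℝ ℝ).compl₁₂ (α ∘ₗ vₗ) sₗ
  have hω : ∀ x y, ω x y = B x.v y.v + x.s * α y.v - α x.v * y.s := fun _ _ => rfl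
  have halt : ω.IsAlt := by
    intro x
    rw [hω, hB x.v]
    ring
  refine ⟨ω, halt, halt.isRefl.nondegenerate_iff_separatingLeft.2 ?_, ?_⟩
  · intro x hx
    have h1 : α x.v = 0 := by
      have := hx ⟨1, 0⟩
      rw [hω] at this
      simpa using this
    have h2 : ∀ w, B x.v w + x.s * α w = 0 := by
      intro w
      have := hx ⟨0, w⟩
      rw [hω] at this
      simpa using this
    have h3 : x.s = 0 := by
      have := h2 z
      rwa [← hB.neg_eq, hz, neg_zero, zero_add, hαz, mul_one] at this
    have h4 : x.v = 0 := by
      refine hrad _ (fun w => ?_) h1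
      have := h2 w
      rw [h3, zero_mul, add_zero] at this
      rw [← hB.neg_eq, this, neg_zero]
    ext1
    · exact h3
    · exact h4
  -- The `α` terms cancel in the cyclic sum; the `B` terms cancel because `A` is skew.
  · intro x y z
    have h1 := hA y.v z.v
    have h2 := hA z.v x.v
    have h3 := hA x.v y.v
    have e1 := hB.neg_eq y.v (A.mulVec z.v)
    have e2 := hB.neg_eq z.v (A.mulVec x.v)
    have e3 := hB.neg_eq x.v (A.mulVec y.v)
    simp only [hω, lie_s, lie_v, map_sub, map_smul, LinearMap.sub_apply, LinearMap.smul_apply,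
      smul_eq_mul]
    rw [h1, h2, h3, ← e1, ← e2, ← e3]
    ring

/-- A symplectic structure restricts to an alternating form on the ideal with radical of dimension
at most one and for which `A` is skew. -/
theorem exists_form_of_admitsSymplectic (h : AdmitsSymplectic (AlmostAbelian A)) :
    ∃ B : LinearMap.BilinForm ℝ (Fin d → ℝ), B.IsAlt ∧
      (∀ v w, B (A.mulVec v) w = -B v (A.mulVec w)) ∧ finrank ℝ (LinearMap.ker B) ≤ 1 := by
  obtain ⟨ω, halt, hnd, hclosed⟩ := h
  refine ⟨ω.compl₁₂ (incl A) (incl A), fun v => halt _, fun v w => ?_, ?_⟩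
  · have h1 := hclosed ⟨1, 0⟩ ⟨0, v⟩ ⟨0, w⟩
    have e1 : ⁅(⟨1, 0⟩ : AlmostAbelian A), (⟨0, v⟩ : AlmostAbelian A)⁆ = incl A (A.mulVec v) := by
      ext1 <;> simp [incl]
    have e2 : ⁅(⟨0, v⟩ : AlmostAbelian A), (⟨0, w⟩ : AlmostAbelian A)⁆ = 0 := by
      ext1 <;> simp
    have e3 : ⁅(⟨0, w⟩ : AlmostAbelian A), (⟨1, 0⟩ : AlmostAbelian A)⁆ =
        -incl A (A.mulVec w) := by
      rw [← map_neg]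
      ext1 <;> simp [incl]
    rw [e1, e2, e3, map_zero, LinearMap.zero_apply, map_neg, LinearMap.neg_apply] at h1
    have h2 := halt.neg_eq (incl A (A.mulVec w)) (incl A v)
    change ω (incl A (A.mulVec v)) (incl A w) = -ω (incl A v) (incl A (A.mulVec w))
    change -ω (incl A (A.mulVec v)) (incl A w) - 0 - -ω (incl A (A.mulVec w)) (incl A v) = 0 at h1
    linarith
  -- Pairing with `e₀` is injective on the radical: a vector of its kernel is orthogonal to the
  -- ideal and to `e₀`, hence zero.
  · let g : LinearMap.ker (ω.compl₁₂ (incl A) (incl A)) →ₗ[ℝ] ℝ :=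
      (ω.flip ⟨1, 0⟩) ∘ₗ incl A ∘ₗ Submodule.subtype _
    have hg : Function.Injective g := by
      rw [← LinearMap.ker_eq_bot, LinearMap.ker_eq_bot']
      rintro ⟨v, hv⟩ hgv
      have hgv : ω (incl A v) ⟨1, 0⟩ = 0 := hgv
      have hv : ∀ w, ω (incl A v) (incl A w) = 0 := fun w => by
        have := LinearMap.congr_fun (LinearMap.mem_ker.1 hv) w
        exact this
      have h0 : incl A v = 0 := by
        refine hnd.1 _ fun y => ?_
        have hy : y = y.s • (⟨1, 0⟩ : AlmostAbelian A) + incl A y.v := by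
          ext1 <;> simp [incl]
        rw [hy, map_add, map_smul, hgv, hv, smul_zero, add_zero]
      exact Subtype.ext (congrArg AlmostAbelian.v h0)
    simpa using LinearMap.finrank_le_finrank_of_injective hg

end AlmostAbelian

/-! ### Jordan tuples as chain data -/

namespace JordanTuple

variable {m : ℕ} (τ : JordanTuple m)

/-- The block sizes, including the size `1` of the blocks of `0_t`. -/
def blockSize : Option (Fin τ.k) → ℕ
  | none => 1
  | some i => τ.n i

/-- The block multiplicities, including the multiplicity `t` of the block size `1`. -/
def blockMult : Option (Fin τ.k) → ℕ
  | none => τ.t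
  | some i => τ.p i

theorem blockSize_injective : Function.Injective τ.blockSize := by
  rintro (_ | i) (_ | j) h
  · rfl
  · have := τ.two_le_n j
    simp only [blockSize] at h
    omega
  · have := τ.two_le_n i
    simp only [blockSize] at h
    omega
  · rw [τ.n_strictAnti.injective h]

/-- The index set of the Jordan matrix, with `0_t` regarded as `t` blocks of size one. -/
def chainIndexEquiv : JordanChainIndex τ.blockSize τ.blockMult ≃ τ.Index where
  toFun
    | ⟨none, a, _⟩ => Sum.inr a
    | ⟨some i, a, u⟩ => Sum.inl ⟨⟨i, a⟩, u⟩
  invFun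
    | Sum.inr a => ⟨none, a, ⟨0, Nat.one_pos⟩⟩
    | Sum.inl ⟨⟨i, a⟩, u⟩ => ⟨some i, a, u⟩
  left_inv := by
    rintro ⟨_ | i, a, u⟩
    · obtain rfl : u = ⟨0, Nat.one_pos⟩ := Fin.ext (Nat.lt_one_iff.1 u.2)
      rfl
    · rfl
  right_inv := by
    rintro (⟨⟨i, a⟩, u⟩ | a) <;> rfl

theorem matrix_apply_chainIndexEquiv (i : Option (Fin τ.k)) (a : Fin (τ.blockMult i))
    (u : Fin (τ.blockSize i)) (x : τ.Index) :
    τ.matrix x (τ.chainIndexEquiv ⟨i, a, u⟩) =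
      if h : (u : ℕ) + 1 < τ.blockSize i then
        if x = τ.chainIndexEquiv ⟨i, a, ⟨u + 1, h⟩⟩ then 1 else 0
      else 0 := by
  rcases i with _ | i
  · rw [dif_neg (by simp [blockSize])]
    rcases x with x | x <;> rfl
  · change Fin (τ.p i) at a
    change Fin (τ.n i) at u
    rcases x with ⟨⟨j, c⟩, v⟩ | x
    · change Matrix.blockDiagonal' (fun x : (Σ i : Fin τ.k, Fin (τ.p i)) =>
        nilpotentJordanBlock (τ.n x.1)) ⟨⟨j, c⟩, v⟩ ⟨⟨i, a⟩, u⟩ = _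
      by_cases h : (⟨j, c⟩ : Σ i : Fin τ.k, Fin (τ.p i)) = ⟨i, a⟩
      · obtain ⟨rfl, h⟩ := Sigma.mk.inj_iff.1 h
        obtain rfl := eq_of_heq h
        refine (Matrix.blockDiagonal'_apply_eq _ _ _ _).trans ?_
        simp only [nilpotentJordanBlock, Matrix.of_apply, blockSize, chainIndexEquiv,
          Equiv.coe_fn_mk, Sum.inl.injEq, Sigma.mk.injEq, heq_eq_eq, true_and, Fin.ext_iff]
        split_ifs <;> first | rfl | (exfalso; omega)
      · refine (Matrix.blockDiagonal'_apply_ne _ _ _ h).trans ?_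
        split_ifs with h1 h2
        · simp only [chainIndexEquiv, Equiv.coe_fn_mk, Sum.inl.injEq] at h2
          exact absurd (congrArg Sigma.fst h2) h
        · rfl
        · rfl
    · change (0 : ℝ) = _
      split_ifs with h1 h2
      · cases h2
      · rfl
      · rfl

/-- Size 1 is odd, so the two alternatives record whether the unique odd size of odd multiplicity is
1 or some `n l`. -/
theorem existsUnique_odd_odd_iff :
    (∃! i, Odd (τ.blockSize i) ∧ Odd (τ.blockMult i)) ↔
      (Odd τ.t ∧ ∀ i : Fin τ.k, Odd (τ.n i) → Even (τ.p i)) ∨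
      (Even τ.t ∧ ∃! l : Fin τ.k, Odd (τ.n l) ∧ Odd (τ.p l)) := by
  constructor
  · rintro ⟨_ | i, ⟨h1, h2⟩, h⟩
    · refine Or.inl ⟨h2, fun i hi => ?_⟩
      by_contra hp
      cases h (some i) ⟨hi, Nat.not_even_iff_odd.1 hp⟩
    · refine Or.inr ⟨?_, i, ⟨h1, h2⟩, fun j hj => Option.some_injective _ (h (some j) hj)⟩
      by_contra ht
      cases h none ⟨odd_one, Nat.not_even_iff_odd.1 ht⟩
  · rintro (⟨ht, h⟩ | ⟨ht, i, hi, h⟩)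
    · refine ⟨none, ⟨odd_one, ht⟩, ?_⟩
      rintro (_ | i) ⟨h1, h2⟩
      · rfl
      · exact absurd (h i h1) (Nat.not_even_iff_odd.2 h2)
    · refine ⟨some i, hi, ?_⟩
      rintro (_ | j) hj
      · exact absurd ht (Nat.not_even_iff_odd.2 hj.2)
      · rw [h j hj]

end JordanTuple

theorem HasJordanTuple.exists_isJordanChainBasis {m : ℕ} {M : Matrix (Fin m) (Fin m) ℝ}
    {τ : JordanTuple m} (h : HasJordanTuple M τ) :
    ∃ b : Basis (JordanChainIndex τ.blockSize τ.blockMult) ℝ (Fin m → ℝ),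
      IsJordanChainBasis M.mulVecLin b := by
  obtain ⟨e, c, hc⟩ := h
  have hc : (c : Matrix (Fin m) (Fin m) ℝ) * Matrix.reindex e e τ.matrix = M * c := hc
  let L : (Fin m → ℝ) ≃ₗ[ℝ] (Fin m → ℝ) := Matrix.toLin'OfInv c.inv_mul c.mul_inv
  have hL : ∀ v, L v = (c : Matrix (Fin m) (Fin m) ℝ).mulVec v := fun v => by
    simp [L, Matrix.toLin'OfInv]
  -- The columns of the conjugating matrix `c`, renumbered, form the Jordan basis.
  let b : Basis (JordanChainIndex τ.blockSize τ.blockMult) ℝ (Fin m → ℝ) :=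
    ((Pi.basisFun ℝ (Fin m)).map L).reindex (τ.chainIndexEquiv.trans e).symm
  have hb : ∀ x, b x = (c : Matrix (Fin m) (Fin m) ℝ).mulVec
      (Pi.single (e (τ.chainIndexEquiv x)) 1) := by
    intro x
    simp [b, hL]
  refine ⟨b, fun i a u => ?_⟩
  rw [Matrix.mulVecLin_apply, hb, Matrix.mulVec_mulVec, ← hc, ← Matrix.mulVec_mulVec]
  have hcol : (Matrix.reindex e e τ.matrix).mulVec
      (Pi.single (e (τ.chainIndexEquiv ⟨i, a, u⟩)) 1) =
      if h : (u : ℕ) + 1 < τ.blockSize i then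
        Pi.single (e (τ.chainIndexEquiv ⟨i, a, ⟨u + 1, h⟩⟩)) 1 else 0 := by
    ext x
    rw [Matrix.mulVec_single_one, Matrix.col_apply, Matrix.reindex_apply, Matrix.submatrix_apply,
      Equiv.symm_apply_apply, τ.matrix_apply_chainIndexEquiv]
    split_ifs with h1 h2
    · rw [← h2]; simp
    · rw [Pi.single_eq_of_ne]
      rintro rfl
      exact h2 (by simp)
    · rfl
  rw [hcol]
  split_ifs with h1
  · rw [hb]
  · rw [Matrix.mulVec_zero]

/-! ### The classification -/

theorem theorem5p7 (n : ℕ) (M : Matrix (Fin (2 * n - 1)) (Fin (2 * n - 1)) ℝ)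
    (hM : LieRing.IsNilpotent (AlmostAbelian M))
    (τ : JordanTuple (2 * n - 1)) (hτ : HasJordanTuple M τ) :
    AdmitsSymplectic (AlmostAbelian M) ↔
      (Odd τ.t ∧ ∀ i : Fin τ.k, Odd (τ.n i) → Even (τ.p i)) ∨
      (Even τ.t ∧ ∃! l : Fin τ.k, Odd (τ.n l) ∧ Odd (τ.p l)) := by
  obtain ⟨b, hb⟩ := hτ.exists_isJordanChainBasis
  rw [← τ.existsUnique_odd_odd_iff]
  constructor
  · intro h
    obtain ⟨B, hB, hskew, hker⟩ := AlmostAbelian.exists_form_of_admitsSymplectic h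
    refine hb.existsUnique_odd_odd τ.blockSize_injective hB hskew hker ?_
    rw [Module.finrank_fin_fun]
    -- The existence of a block excludes `n = 0`, where truncated `2 * n - 1` would be even.
    have hpos : 0 < 2 * n - 1 := by
      rw [← τ.sum_eq]
      have i : Fin τ.k := ⟨0, τ.one_le_k⟩
      refine Nat.add_pos_left (Finset.sum_pos' (fun _ _ => Nat.zero_le _)
        ⟨i, Finset.mem_univ i, ?_⟩) _
      exact Nat.mul_pos (by have := τ.two_le_n i; omega) (τ.p_pos i)
    exact ⟨n - 1, by omega⟩
  · intro h
    obtain ⟨B, α, z, hB, hskew, hz, hαz, hrad⟩ := hb.exists_isAlt h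
    exact AlmostAbelian.admitsSymplectic_of_form hB hskew hz hαz hrad
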